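/- There is an absolute constant $C>0$ such that for every $\varepsilon>0$ there is a deterministic one-pass streaming algorithm for weighted matroid intersection with the following guarantee. Let $M_1,M_2$ be matroids on a common finite ground set $E$ and let $w:E\to\mathbb{R}_{>0}$. The elements of $E$ arrive one by one, each together with its weight, in an arbitrary order; the algorithm knows $\varepsilon$ but none of $E$, $M_1$, $M_2$, $w$ in advance, and it may at any time query independence oracles of $M_1$ and $M_2$ on sets consisting of elements currently in its memory and the element that has just arrived. After a single pass it outputs a $(\tfrac12-\varepsilon)$-approximate maximum weight common independent set, that is, a set $S$ independent in both $M_1$ and $M_2$ such that $w(S)\ge(\tfrac12-\varepsilon)\,w(I)$ for every common independent set $I$. Throughout the pass its memory consists of at most $$C\cdot\gamma_\varepsilon\cdot r\cdot(1+\log W)$$ cells, each holding one previously read element with its weight. Here $\gamma_\varepsilon=\lceil(1/\varepsilon)^{1/\varepsilon}\rceil$, $r$ is the maximum cardinality of a common independent set of $M_1$ and $M_2$, and $W=\max_{e\in E}w(e)/\min_{e\in E}w(e)$ (if $E=\emptyset$, then $r=0$ and the bound is read as $0$). -/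

import Mathlib

/-- The parameter `⌈(1/ε)^(1/ε)⌉`. -/
noncomputable def gammaEps (ε : ℝ) : ℕ := ⌈(1 / ε) ^ (1 / ε)⌉₊

/-- The weight ratio `max w / min w` over a (finite) ground set `E`. -/
noncomputable def weightRatio {α : Type*} (E : Set α) (w : α → ℝ) : ℝ :=
  sSup (w '' E) / sInf (w '' E)

/-- `I` is a common independent set of the two matroids. -/
def IsCommonIndep {α : Type*} (M₁ M₂ : Matroid α) (I : Finset α) : Prop :=
  M₁.Indep (I : Set α) ∧ M₂.Indep (I : Set α)

/-- The rank of the intersection: the largest size of a common independent set. -/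
noncomputable def commonRank {α : Type*} (M₁ M₂ : Matroid α) : ℕ :=
  sSup {k | ∃ I : Finset α, IsCommonIndep M₁ M₂ I ∧ I.card = k}

/-- `S` is an `a`-approximate maximum weight common independent set: it is a common independent
set whose weight is at least `a` times the weight of every common independent set. -/
def IsApproxMaxWeightCommonIndep {α : Type*} (M₁ M₂ : Matroid α) (w : α → ℝ) (a : ℝ)
    (S : Finset α) : Prop :=
  IsCommonIndep M₁ M₂ S ∧
    ∀ I : Finset α, IsCommonIndep M₁ M₂ I → a * ∑ e ∈ I, w e ≤ ∑ e ∈ S, w e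

/-- The independence oracle of `M`, available only for sets of elements that are contained in `R`:
a query on `I` is answered positively iff `I ⊆ R` and `I` is independent. -/
def indepOracle {α : Type*} (M : Matroid α) (R : Set α) : Set α → Prop :=
  fun I => I ⊆ R ∧ M.Indep I

/-- The elements held in a memory, where a memory is a finite sequence of cells and each cell holds
one element together with its weight. -/
def storedElements {α : Type*} (m : List (α × ℝ)) : Set α := {e | ∃ c : ℝ, (e, c) ∈ m}

/-- A deterministic one-pass streaming algorithm (in the independence oracle model) for weighted
matroid intersection, with element names from `α`. The memory that is carried from one arrival to
the next consists of cells each holding an element read earlier with its weight; nothing else is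
carried over. When an item arrives, the new memory is computed from the old one, the item, and the
answers of the two oracles; it can only hold items that were in memory or have just arrived.
At the end of the stream a set of stored elements is output. -/
structure OnePassAlgorithm (α : Type*) where
  /-- new memory from old memory, arriving item, and the two oracles -/
  update : List (α × ℝ) → α × ℝ → (Set α → Prop) → (Set α → Prop) → List (α × ℝ)
  update_subset : ∀ m a O₁ O₂, ∀ x ∈ update m a O₁ O₂, x ∈ m ∨ x = a
  /-- the answer from the final memory and the two oracles -/
  output : List (α × ℝ) → (Set α → Prop) → (Set α → Prop) → Finset α
  output_subset : ∀ m O₁ O₂, (output m O₁ O₂ : Set α) ⊆ storedElements m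

namespace OnePassAlgorithm

/-- The memory after reading the stream `σ`, starting from the empty memory. The oracles may be
queried only on sets made up of stored elements and the arriving element. -/
def memory {α : Type*} (A : OnePassAlgorithm α) (M₁ M₂ : Matroid α) (w : α → ℝ) (σ : List α) :
    List (α × ℝ) :=
  σ.foldl (fun m e => A.update m (e, w e)
    (indepOracle M₁ (insert e (storedElements m)))
    (indepOracle M₂ (insert e (storedElements m)))) []

/-- The set that is output after the single pass over the stream `σ`. -/
def result {α : Type*} (A : OnePassAlgorithm α) (M₁ M₂ : Matroid α) (w : α → ℝ) (σ : List α) :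
    Finset α :=
  A.output (A.memory M₁ M₂ w σ)
    (indepOracle M₁ (storedElements (A.memory M₁ M₂ w σ)))
    (indepOracle M₂ (storedElements (A.memory M₁ M₂ w σ)))

/-- On the stream `σ` the algorithm uses space at most `s`: at every point of the pass (after every
prefix of the stream) at most `s` memory cells are in use. -/
def UsesSpaceAtMost {α : Type*} (A : OnePassAlgorithm α) (M₁ M₂ : Matroid α) (w : α → ℝ)
    (σ : List α) (s : ℝ) : Prop :=
  ∀ τ : List α, τ <+: σ → ((A.memory M₁ M₂ w τ).length : ℝ) ≤ s

end OnePassAlgorithm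

/-! The algorithm is the local ratio method. For an arriving `e`, let `a` be the largest threshold
at which the kept elements of `u`-weight at least that threshold span `e` in `M₁`, and `b` the
analogue for `v` in `M₂`, both capped at `w e`. Keep `e` iff `(1 + δ) * (a + b) < w e`, and then set
`u e = w e - b`, `v e = w e - a`. Its gain is `w e - a - b = u e + v e - w e`. Nothing is ever
discarded, and the output is an optimal common independent set of kept elements.

Let `layerRank` denote the maximum `u`-weight of an independent subset, as an integral of ranks of
superlevel sets. Keeping `e` raises it by exactly the gain, in both matroids, so over the whole
stack it equals the total gain `G`. Every element `x` of the stream satisfies `w x ≤ (1 + δ) * (a +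
b)` for thresholds that span it, so `w(I) ≤ 2 (1 + δ) G` for every common independent `I`
(`weight_le_gain`).

Conversely, a kernel `T` of the stack, ordered by `u` in `M₁` and by `v` in `M₂`, has `w(T) ≥ G`
(`exists_gain_le_weight`). Together these give the ratio `1 / (2 (1 + δ)) ≥ 1/2 - δ`.

For space, kept elements whose `u`-weights lie within a factor `1 + δ` are independent in `M₁`
(`indep_weight_class`), and similarly for `v` and `M₂`. A largest common independent subset of the
stack spans each kept element in one of the matroids, so the stack has at most `2 r` elements per
weight class (`length_le`). -/

open MeasureTheory

/-! ### Superlevel sets of a weight function. -/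

/-- The elements of `D` whose `u`-value is at least `θ`. -/
def superlevel {α : Type*} (u : α → ℝ) (D : Set α) (θ : ℝ) : Set α := {x | x ∈ D ∧ θ ≤ u x}

section Superlevel

variable {α : Type*} {u v : α → ℝ} {D D' : Set α} {θ θ' : ℝ} {e : α}

lemma superlevel_subset : superlevel u D θ ⊆ D := fun _ h => h.1

lemma superlevel_mono (h : D ⊆ D') : superlevel u D θ ⊆ superlevel u D' θ :=
  fun _ hx => ⟨h hx.1, hx.2⟩

lemma superlevel_anti (h : θ ≤ θ') : superlevel u D θ' ⊆ superlevel u D θ :=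
  fun _ hx => ⟨hx.1, h.trans hx.2⟩

lemma superlevel_congr (h : ∀ x ∈ D, u x = v x) : superlevel u D θ = superlevel v D θ := by
  ext x
  constructor
  · exact fun hx => ⟨hx.1, by rw [← h x hx.1]; exact hx.2⟩
  · exact fun hx => ⟨hx.1, by rw [h x hx.1]; exact hx.2⟩

lemma superlevel_insert_of_le (h : θ ≤ u e) :
    superlevel u (insert e D) θ = insert e (superlevel u D θ) := by
  ext x
  simp only [superlevel, Set.mem_insert_iff, Set.mem_ofPred_eq]
  constructor
  · rintro ⟨rfl | hx, h'⟩
    · exact Or.inl rfl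
    · exact Or.inr ⟨hx, h'⟩
  · rintro (rfl | hx)
    · exact ⟨Or.inl rfl, h⟩
    · exact ⟨Or.inr hx.1, hx.2⟩

lemma superlevel_insert_of_lt (h : u e < θ) :
    superlevel u (insert e D) θ = superlevel u D θ := by
  ext x
  simp only [superlevel, Set.mem_insert_iff, Set.mem_ofPred_eq]
  constructor
  · rintro ⟨rfl | hx, h'⟩
    · exact absurd h' (not_le.2 h)
    · exact ⟨hx, h'⟩
  · exact fun hx => ⟨Or.inr hx.1, hx.2⟩

end Superlevel

/-! ### Ranks of finite sets as natural numbers. -/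

namespace Matroid

variable {α : Type*} {M : Matroid α} {X Y : Set α} {e : α}

/-- The rank of a set as a natural number (zero if the rank is infinite). -/
noncomputable def finRk (M : Matroid α) (X : Set α) : ℕ := (M.eRk X).toNat

lemma eRk_ne_top_of_finite (hX : X.Finite) : M.eRk X ≠ ⊤ :=
  ne_top_of_le_ne_top (Set.encard_ne_top_iff.2 hX) (M.eRk_le_encard X)

lemma finRk_le_of_subset_closure (hY : Y.Finite) (h : X ⊆ M.closure Y) :
    M.finRk X ≤ M.finRk Y :=
  ENat.toNat_le_toNat ((M.eRk_mono h).trans_eq (M.eRk_closure_eq Y)) (eRk_ne_top_of_finite hY)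

lemma finRk_mono (hY : Y.Finite) (h : X ⊆ Y) : M.finRk X ≤ M.finRk Y :=
  ENat.toNat_le_toNat (M.eRk_mono h) (eRk_ne_top_of_finite hY)

lemma finRk_insert_le (hX : X.Finite) : M.finRk (insert e X) ≤ M.finRk X + 1 := by
  have h := ENat.toNat_le_toNat (M.eRk_insert_le_add_one e X)
    (by simpa using eRk_ne_top_of_finite (M := M) hX)
  rwa [ENat.toNat_add (eRk_ne_top_of_finite hX) (by simp)] at h

lemma finRk_insert_of_notMem_closure (hX : X.Finite) (heE : e ∈ M.E) (he : e ∉ M.closure X) :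
    M.finRk (insert e X) = M.finRk X + 1 := by
  rw [finRk, eRk_insert_eq_add_one ⟨heE, he⟩, ENat.toNat_add (eRk_ne_top_of_finite hX) (by simp)]
  rfl

lemma finRk_insert_of_mem_closure (he : e ∈ M.closure X) :
    M.finRk (insert e X) = M.finRk X := by
  rw [finRk, ← eRk_closure_eq, closure_insert_eq_of_mem_closure he, eRk_closure_eq]; rfl

lemma finRk_coe_le_card (T : Finset α) : M.finRk (T : Set α) ≤ T.card := by
  have h := ENat.toNat_le_toNat (M.eRk_le_encard (T : Set α)) (by simp)
  simpa [finRk] using h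

lemma Indep.card_le_finRk {I : Finset α} (hI : M.Indep (I : Set α)) (hY : Y.Finite)
    (h : (I : Set α) ⊆ M.closure Y) : I.card ≤ M.finRk Y := by
  refine le_trans (le_of_eq ?_) (finRk_le_of_subset_closure hY h)
  rw [finRk, hI.eRk_eq_encard]; simp

end Matroid

/-! ### Maximum independent weight as a layer-cake integral of ranks. -/

section LayerCake

lemma integrableOn_step_le (B c : ℝ) :
    IntegrableOn (fun θ : ℝ => if θ ≤ c then (1 : ℝ) else 0) (Set.Ioc 0 B) := by
  refine IntegrableOn.mono_set ?_ Set.Ioc_subset_Icc_self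
  refine AntitoneOn.integrableOn_isCompact isCompact_Icc (fun a _ b _ hab => ?_)
  split_ifs <;> linarith

lemma integrableOn_step_lt (B c : ℝ) :
    IntegrableOn (fun θ : ℝ => if θ < c then (1 : ℝ) else 0) (Set.Ioc 0 B) := by
  refine IntegrableOn.mono_set ?_ Set.Ioc_subset_Icc_self
  refine AntitoneOn.integrableOn_isCompact isCompact_Icc (fun a _ b _ hab => ?_)
  split_ifs <;> linarith

lemma integral_step_le {B c : ℝ} (hc : 0 ≤ c) (hB : c ≤ B) :
    ∫ θ in Set.Ioc 0 B, (if θ ≤ c then (1 : ℝ) else 0) = c := by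
  have h : (fun θ : ℝ => if θ ≤ c then (1 : ℝ) else 0) = (Set.Iic c).indicator 1 := by
    ext θ; simp [Set.indicator_apply]
  rw [h, setIntegral_indicator measurableSet_Iic]
  have h2 : Set.Ioc 0 B ∩ Set.Iic c = Set.Ioc 0 c := by
    ext θ; simp only [Set.mem_inter_iff, Set.mem_Ioc, Set.mem_Iic]
    exact ⟨fun h => ⟨h.1.1, h.2⟩, fun h => ⟨⟨h.1, h.2.trans hB⟩, h.2⟩⟩
  rw [h2]
  simp [hc]

lemma integral_step_lt {B c : ℝ} (hc : 0 ≤ c) (hB : c ≤ B) :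
    ∫ θ in Set.Ioc 0 B, (if θ < c then (1 : ℝ) else 0) = c := by
  refine Eq.trans (integral_congr_ae (ae_restrict_of_ae ?_)) (integral_step_le hc hB)
  filter_upwards [compl_mem_ae_iff.2 (measure_singleton c)] with θ hθ
  have hne : θ ≠ c := hθ
  simp [lt_iff_le_and_ne, hne]

/-- The largest `u`-weight of an independent subset of `D`, written as the integral of the ranks
of the superlevel sets (all weights are meant to be at most `B`). -/
noncomputable def layerRank {α : Type*} (M : Matroid α) (u : α → ℝ) (B : ℝ) (D : Set α) : ℝ :=
  ∫ θ in Set.Ioc 0 B, (M.finRk (superlevel u D θ) : ℝ)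

variable {α : Type*} {M : Matroid α} {u a : α → ℝ} {B : ℝ} {D : Set α} {e : α}

lemma integrableOn_finRk_superlevel (hD : D.Finite) :
    IntegrableOn (fun θ : ℝ => (M.finRk (superlevel u D θ) : ℝ)) (Set.Ioc 0 B) := by
  refine IntegrableOn.mono_set ?_ Set.Ioc_subset_Icc_self
  refine AntitoneOn.integrableOn_isCompact isCompact_Icc (fun a _ b _ hab => ?_)
  exact Nat.cast_le.2 (Matroid.finRk_mono (hD.subset superlevel_subset) (superlevel_anti hab))

lemma layerRank_empty : layerRank M u B ∅ = 0 := by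
  have h : ∀ θ, superlevel u (∅ : Set α) θ = ∅ := fun θ =>
    Set.subset_empty_iff.1 superlevel_subset
  simp [layerRank, h, Matroid.finRk]

/-- For `a < θ ≤ u e` the new element raises the rank of the superlevel set by one; integrating over
these `θ` gives `u e - a`. -/
lemma le_layerRank_insert {a : ℝ} (hD : D.Finite) (heE : e ∈ M.E) (ha : 0 ≤ a) (hau : a ≤ u e)
    (hB : u e ≤ B) (h : ∀ θ, a < θ → θ ≤ u e → e ∉ M.closure (superlevel u D θ)) :
    layerRank M u B D + (u e - a) ≤ layerRank M u B (insert e D) := by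
  have key : ∫ θ in Set.Ioc 0 B, ((M.finRk (superlevel u D θ) : ℝ) + if θ ≤ u e then 1 else 0) ≤
      ∫ θ in Set.Ioc 0 B, ((M.finRk (superlevel u (insert e D) θ) : ℝ) + if θ ≤ a then 1 else 0) := by
    refine setIntegral_mono_on ((integrableOn_finRk_superlevel hD).add (integrableOn_step_le B _))
      ((integrableOn_finRk_superlevel (hD.insert e)).add (integrableOn_step_le B _))
      measurableSet_Ioc (fun θ _ => ?_)
    have hf : (superlevel u D θ).Finite := hD.subset superlevel_subset
    by_cases h1 : θ ≤ u e
    · by_cases h2 : θ ≤ a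
      · have := Matroid.finRk_mono (M := M) ((hD.insert e).subset superlevel_subset)
          (superlevel_mono (u := u) (θ := θ) (Set.subset_insert e D))
        simpa [h1, h2] using this
      · rw [superlevel_insert_of_le h1,
          Matroid.finRk_insert_of_notMem_closure hf heE (h θ (not_le.1 h2) h1)]
        simp [h1, h2]
    · have h2 : ¬ θ ≤ a := fun h' => h1 (h'.trans hau)
      rw [superlevel_insert_of_lt (not_le.1 h1)]
      simp [h1, h2]
  rw [integral_add (integrableOn_finRk_superlevel hD) (integrableOn_step_le B _),
    integral_add (integrableOn_finRk_superlevel (hD.insert e)) (integrableOn_step_le B _),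
    integral_step_le (ha.trans hau) hB, integral_step_le ha (hau.trans hB)] at key
  simp only [layerRank]
  linarith

/-- Below `a` the rank does not move and above `u e` the superlevel set does not, so only an
interval of length `u e - a` contributes, by at most one. -/
lemma layerRank_insert_le {a : ℝ} (hD : D.Finite) (ha : 0 ≤ a) (hau : a ≤ u e)
    (hB : u e ≤ B) (h : ∀ θ, 0 < θ → θ < a → e ∈ M.closure (superlevel u D θ)) :
    layerRank M u B (insert e D) ≤ layerRank M u B D + (u e - a) := by
  have key : ∫ θ in Set.Ioc 0 B, ((M.finRk (superlevel u (insert e D) θ) : ℝ) +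
        if θ < a then 1 else 0) ≤
      ∫ θ in Set.Ioc 0 B, ((M.finRk (superlevel u D θ) : ℝ) + if θ ≤ u e then 1 else 0) := by
    refine setIntegral_mono_on
      ((integrableOn_finRk_superlevel (hD.insert e)).add (integrableOn_step_lt B _))
      ((integrableOn_finRk_superlevel hD).add (integrableOn_step_le B _))
      measurableSet_Ioc (fun θ hθ => ?_)
    have hf : (superlevel u D θ).Finite := hD.subset superlevel_subset
    by_cases h1 : θ ≤ u e
    · rw [superlevel_insert_of_le h1]
      by_cases h2 : θ < a
      · rw [Matroid.finRk_insert_of_mem_closure (h θ hθ.1 h2)]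
        simp [h1, h2]
      · have := Matroid.finRk_insert_le (M := M) (e := e) hf
        simp only [h1, h2, if_true, if_false, add_zero]
        exact_mod_cast this
    · have h2 : ¬ θ < a := fun h' => h1 (h'.le.trans hau)
      rw [superlevel_insert_of_lt (not_le.1 h1)]
      simp [h1, h2]
  rw [integral_add (integrableOn_finRk_superlevel hD) (integrableOn_step_le B _),
    integral_add (integrableOn_finRk_superlevel (hD.insert e)) (integrableOn_step_lt B _),
    integral_step_le (ha.trans hau) hB, integral_step_lt ha (hau.trans hB)] at key
  simp only [layerRank]
  linarith

/-- At each level `θ`, the part of `T` above `θ` spans the part of `D` above `θ`, so its cardinality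
bounds the rank. -/
lemma layerRank_le_sum {T : Finset α} (hT : ∀ x ∈ T, 0 ≤ u x ∧ u x ≤ B)
    (h : ∀ e ∈ D, e ∈ M.closure (superlevel u (T : Set α) (u e))) (hD : D.Finite) :
    layerRank M u B D ≤ ∑ x ∈ T, u x := by
  have hsum : ∑ x ∈ T, u x = ∫ θ in Set.Ioc 0 B, ∑ x ∈ T, (if θ ≤ u x then (1 : ℝ) else 0) := by
    rw [integral_finsetSum _ (fun x _ => integrableOn_step_le B (u x))]
    exact Finset.sum_congr rfl fun x hx => (integral_step_le (hT x hx).1 (hT x hx).2).symm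
  rw [hsum]
  refine setIntegral_mono_on (integrableOn_finRk_superlevel hD)
    (integrable_finsetSum _ fun x _ => integrableOn_step_le B (u x)) measurableSet_Ioc
    (fun θ _ => ?_)
  classical
  rw [Finset.sum_boole]
  have hc : superlevel u (T : Set α) θ = ((T.filter fun x => θ ≤ u x : Finset α) : Set α) := by
    ext x; simp [superlevel]
  refine Nat.cast_le.2 (le_trans (Matroid.finRk_le_of_subset_closure (Finset.finite_toSet _)
    (fun e he => ?_)) (Matroid.finRk_coe_le_card (M := M) (T.filter fun x => θ ≤ u x)))
  rw [← hc]
  exact M.closure_subset_closure (superlevel_anti he.2) (h e he.1)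

/-- At each level `θ > 0`, the `x ∈ I` with `a x > θ` form an independent set spanned by the
superlevel set of `D`. -/
lemma sum_le_layerRank {I : Finset α} (hI : M.Indep (I : Set α))
    (ha : ∀ x ∈ I, 0 ≤ a x ∧ a x ≤ B)
    (h : ∀ x ∈ I, ∀ θ, 0 < θ → θ < a x → x ∈ M.closure (superlevel u D θ)) (hD : D.Finite) :
    ∑ x ∈ I, a x ≤ layerRank M u B D := by
  have hsum : ∑ x ∈ I, a x = ∫ θ in Set.Ioc 0 B, ∑ x ∈ I, (if θ < a x then (1 : ℝ) else 0) := by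
    rw [integral_finsetSum _ (fun x _ => integrableOn_step_lt B (a x))]
    exact Finset.sum_congr rfl fun x hx => (integral_step_lt (ha x hx).1 (ha x hx).2).symm
  rw [hsum]
  refine setIntegral_mono_on (integrable_finsetSum _ fun x _ => integrableOn_step_lt B (a x))
    (integrableOn_finRk_superlevel hD) measurableSet_Ioc (fun θ hθ => ?_)
  classical
  rw [Finset.sum_boole]
  refine Nat.cast_le.2 (Matroid.Indep.card_le_finRk (hI.subset ?_)
    (hD.subset superlevel_subset) (fun x hx => ?_))
  · exact_mod_cast Finset.filter_subset _ _
  · have hx' := Finset.mem_filter.1 (Finset.mem_coe.1 hx)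
    exact h x hx'.1 θ hθ.1 hx'.2

end LayerCake

/-! ### Kernels of two ordered matroids. -/

section Kernel

variable {α β : Type*} [LinearOrder β] {M : Matroid α} {key : α → β} {S X : Set α} {e : α}

/-- The elements of `S` that are spanned in `M` by elements of `X` with a strictly larger key. -/
def dominated (M : Matroid α) (key : α → β) (S X : Set α) : Set α :=
  {e | e ∈ S ∧ e ∈ M.closure {x | x ∈ X ∧ key e < key x}}

lemma dominated_mono {Y : Set α} (h : X ⊆ Y) : dominated M key S X ⊆ dominated M key S Y := by
  refine fun e he => ⟨he.1, M.closure_subset_closure ?_ he.2⟩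
  exact fun x hx => ⟨h hx.1, hx.2⟩

/-- A counterexample of largest key would be dominated, hence spanned by elements of larger key, for
which the claim already holds. -/
lemma mem_closure_sdiff_dominated (hS : S.Finite) (hSE : S ⊆ M.E) (hXS : X ⊆ S) (he : e ∈ X) :
    e ∈ M.closure {x | x ∈ X \ dominated M key S X ∧ key e ≤ key x} := by
  by_contra hcon
  obtain ⟨f, ⟨hfX, hf⟩, hmax⟩ := Set.exists_max_image
    {e | e ∈ X ∧ e ∉ M.closure {x | x ∈ X \ dominated M key S X ∧ key e ≤ key x}} key
    (hS.subset fun x hx => hXS hx.1) ⟨e, he, hcon⟩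
  have hsub : ∀ k, {x | x ∈ X \ dominated M key S X ∧ k ≤ key x} ⊆ M.E :=
    fun k x hx => hSE (hXS hx.1.1)
  by_cases hd : f ∈ dominated M key S X
  · refine hf (Matroid.closure_subset_closure_of_subset_closure ?_ hd.2)
    rintro x ⟨hxX, hlt⟩
    by_contra hx
    refine absurd (hmax x ⟨hxX, fun h => hx ?_⟩) (not_le.2 hlt)
    refine M.closure_subset_closure ?_ h
    exact fun y hy => ⟨hy.1, hlt.le.trans hy.2⟩
  · exact hf (M.mem_closure_of_mem ⟨⟨hfX, hd⟩, le_rfl⟩ (hsub _))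

lemma dominated_sdiff_dominated (hS : S.Finite) (hSE : S ⊆ M.E) (hXS : X ⊆ S) :
    dominated M key S (X \ dominated M key S X) = dominated M key S X := by
  refine Set.Subset.antisymm (dominated_mono Set.sdiff_subset) (fun e he => ⟨he.1, ?_⟩)
  refine Matroid.closure_subset_closure_of_subset_closure ?_ he.2
  rintro x ⟨hxX, hlt⟩
  refine M.closure_subset_closure ?_
    (mem_closure_sdiff_dominated (key := key) hS hSE hXS hxX)
  exact fun y hy => ⟨hy.1, hlt.trans_le hy.2⟩

/-- The element of smallest key in a circuit is spanned by the others, whose keys are strictly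
larger by injectivity, so it is dominated. -/
lemma indep_sdiff_dominated (hS : S.Finite) (hSE : S ⊆ M.E) (hXS : X ⊆ S)
    (hkey : Set.InjOn key S) : M.Indep (X \ dominated M key S X) := by
  by_contra hcon
  have hsub : X \ dominated M key S X ⊆ S := Set.sdiff_subset.trans hXS
  have hdep : M.Dep (X \ dominated M key S X) := ⟨hcon, hsub.trans hSE⟩
  obtain ⟨C, hC, hCi⟩ := hdep.exists_isCircuit_subset
  obtain ⟨f, hf, hmin⟩ := Set.exists_min_image C key (hS.subset (hC.trans hsub)) hCi.nonempty
  refine (hC hf).2 ⟨hsub (hC hf), ?_⟩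
  refine M.closure_subset_closure ?_ (hCi.mem_closure_sdiff_singleton_of_mem hf)
  rintro x ⟨hx, hne⟩
  refine ⟨(hC hx).1, lt_of_le_of_ne (hmin x hx) (fun h => hne ?_)⟩
  exact (hkey (hsub (hC hf)) (hsub (hC hx)) h).symm

/-- Fleiner's theorem: two ordered matroids have a kernel. -/
theorem exists_matroid_kernel {β' : Type*} [LinearOrder β'] {M₁ M₂ : Matroid α} {k₁ : α → β}
    {k₂ : α → β'} (hS : S.Finite) (h₁ : S ⊆ M₁.E) (h₂ : S ⊆ M₂.E) (hk₁ : Set.InjOn k₁ S)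
    (hk₂ : Set.InjOn k₂ S) :
    ∃ T ⊆ S, M₁.Indep T ∧ M₂.Indep T ∧
      S ⊆ T ∪ dominated M₁ k₁ S T ∪ dominated M₂ k₂ S T := by
  let F : Set α →o Set α :=
    ⟨fun X => S \ dominated M₁ k₁ S (S \ dominated M₂ k₂ S X), fun X Y h =>
      Set.sdiff_subset_sdiff_right (dominated_mono (Set.sdiff_subset_sdiff_right
        (dominated_mono h)))⟩
  -- Knaster–Tarski: domination is monotone and complemented twice. The fixed point gives `X = S \
  -- dom₁ Y` and `Y = S \ dom₂ X`; the kernel is `X ∩ Y`, which dominates whatever `Y` or `X`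
  -- dominates.
  set X := F.lfp with hXdef
  set Y := S \ dominated M₂ k₂ S X with hY
  have hX : S \ dominated M₁ k₁ S Y = X := F.map_lfp
  have hXS : X ⊆ S := hX ▸ Set.sdiff_subset
  have hYS : Y ⊆ S := Set.sdiff_subset
  have hT2 : X ∩ Y = X \ dominated M₂ k₂ S X := by
    rw [hY]; ext x
    exact ⟨fun h => ⟨h.1, h.2.2⟩, fun h => ⟨h.1, hXS h.1, h.2⟩⟩
  have hT1 : X ∩ Y = Y \ dominated M₁ k₁ S Y := by
    rw [← hX]; ext x
    exact ⟨fun h => ⟨h.2, h.1.2⟩, fun h => ⟨⟨hYS h.1, h.2⟩, h.1⟩⟩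
  refine ⟨X ∩ Y, fun x hx => hXS hx.1, ?_, ?_, fun x hx => ?_⟩
  · rw [hT1]; exact indep_sdiff_dominated hS h₁ hYS hk₁
  · rw [hT2]; exact indep_sdiff_dominated hS h₂ hXS hk₂
  · by_cases hxX : x ∈ X
    · by_cases hxY : x ∈ Y
      · exact Or.inl (Or.inl ⟨hxX, hxY⟩)
      · right
        rw [hT2, dominated_sdiff_dominated hS h₂ hXS]
        by_contra h
        exact hxY ⟨hx, h⟩
    · left; right
      rw [hT1, dominated_sdiff_dominated hS h₁ hYS]
      by_contra h
      exact hxX (hX ▸ ⟨hx, h⟩)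

end Kernel

/-! ### Critical weights computed from independence oracles. -/

section CriticalWeight

variable {α : Type*}

/-- A set of `X` witnesses, according to the independence oracle `O`, that `e` is spanned by `X`. -/
def OracleSpans (O : Set α → Prop) (X : Set α) (e : α) : Prop :=
  ∃ I ⊆ X, O I ∧ ¬ O (insert e I)

/-- The largest threshold `θ ≤ c` for which `e` is spanned by the elements of `D` of `u`-weight
at least `θ` (zero if there is none). -/
noncomputable def critWeight (O : Set α → Prop) (u : α → ℝ) (D : Set α) (e : α) (c : ℝ) : ℝ :=
  -- The cap `c` bounds the set, so a loop has critical weight `c` when `c ≥ 0` and is not kept.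
  sSup {θ | 0 ≤ θ ∧ θ ≤ c ∧ (θ = 0 ∨ OracleSpans O (superlevel u D θ) e)}

variable {M : Matroid α} {u v : α → ℝ} {D R X : Set α} {e : α} {c θ : ℝ}

lemma oracleSpans_indepOracle (hX : X ⊆ R) (he : e ∈ R) :
    OracleSpans (indepOracle M R) X e ↔ OracleSpans M.Indep X e := by
  refine exists_congr fun I => and_congr_right fun hI => ?_
  have h1 : I ⊆ R := hI.trans hX
  have h2 : insert e I ⊆ R := Set.insert_subset he h1
  simp only [indepOracle, h1, h2, true_and]

/-- A basis of `X` is the witness. If `e` were in `X`, a witness containing `e` would be impossible,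
which is why `e ∉ X` is needed. -/
lemma oracleSpans_indep_iff (hX : X ⊆ M.E) (he : e ∈ M.E) (heX : e ∉ X) :
    OracleSpans M.Indep X e ↔ e ∈ M.closure X := by
  constructor
  · rintro ⟨I, hIX, hI, hIe⟩
    refine M.closure_subset_closure hIX (by_contra fun h => hIe ?_)
    exact hI.insert_indep_iff.2 (Or.inl ⟨he, h⟩)
  · intro h
    obtain ⟨I, hI⟩ := M.exists_isBasis X
    refine ⟨I, hI.subset, hI.indep, fun hIe => ?_⟩
    rw [← hI.closure_eq_closure] at h
    exact (hI.indep.notMem_closure_iff_of_notMem (fun h' => heX (hI.subset h'))).2 hIe h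

lemma critWeight_indepOracle (hD : D ⊆ R) (he : e ∈ R) :
    critWeight (indepOracle M R) u D e c = critWeight M.Indep u D e c := by
  unfold critWeight
  simp_rw [oracleSpans_indepOracle (superlevel_subset.trans hD) he]

lemma critWeight_congr {O : Set α → Prop} (h : ∀ x ∈ D, u x = v x) :
    critWeight O u D e c = critWeight O v D e c := by
  unfold critWeight
  simp_rw [superlevel_congr h]

lemma critWeight_nonneg (O : Set α → Prop) : 0 ≤ critWeight O u D e c :=
  Real.sSup_nonneg fun _ h => h.1

lemma critWeight_le (O : Set α → Prop) (hc : 0 ≤ c) : critWeight O u D e c ≤ c :=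
  Real.sSup_le (fun _ h => h.2.1) hc

lemma mem_closure_of_lt_critWeight (hD : D ⊆ M.E) (he : e ∈ M.E) (heD : e ∉ D) (hθ : 0 < θ)
    (h : θ < critWeight M.Indep u D e c) : e ∈ M.closure (superlevel u D θ) := by
  have hne : {θ | 0 ≤ θ ∧ θ ≤ c ∧ (θ = 0 ∨ OracleSpans M.Indep (superlevel u D θ) e)}.Nonempty := by
    rw [Set.nonempty_iff_ne_empty]
    intro h0
    rw [critWeight, h0, Real.sSup_empty] at h
    exact lt_asymm hθ h
  obtain ⟨t, ⟨_, _, ht⟩, hlt⟩ := exists_lt_of_lt_csSup hne h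
  have ht' := ht.resolve_left (hθ.trans hlt).ne'
  rw [oracleSpans_indep_iff (superlevel_subset.trans hD) he
    (fun h' => heD (superlevel_subset h'))] at ht'
  exact M.closure_subset_closure (superlevel_anti hlt.le) ht'

lemma le_critWeight (hD : D ⊆ M.E) (he : e ∈ M.E) (heD : e ∉ D) (hθ : 0 ≤ θ) (hc : θ ≤ c)
    (h : e ∈ M.closure (superlevel u D θ)) : θ ≤ critWeight M.Indep u D e c := by
  refine le_csSup ⟨c, fun _ h => h.2.1⟩ ⟨hθ, hc, Or.inr ?_⟩
  exact (oracleSpans_indep_iff (superlevel_subset.trans hD) he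
    (fun h' => heD (superlevel_subset h'))).2 h

end CriticalWeight

/-! ### The local ratio stack: gains, covering and approximation. -/

/-- `IsLocalRatioStack M₁ M₂ w δ u v L`: the elements of `L` (last arrival first) were selected by
the local ratio rule with slack `δ`, and `u`, `v` are the weights they obtained in `M₁`, `M₂`. -/
inductive IsLocalRatioStack {α : Type*} (M₁ M₂ : Matroid α) (w : α → ℝ) (δ : ℝ) (u v : α → ℝ) :
    List α → Prop
  | nil : IsLocalRatioStack M₁ M₂ w δ u v []
  | cons {e : α} {L : List α} : IsLocalRatioStack M₁ M₂ w δ u v L → e ∉ L → e ∈ M₁.E → e ∈ M₂.E →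
      0 < w e →
      u e = w e - critWeight M₂.Indep v {x | x ∈ L} e (w e) →
      v e = w e - critWeight M₁.Indep u {x | x ∈ L} e (w e) →
      (1 + δ) * (critWeight M₁.Indep u {x | x ∈ L} e (w e) +
        critWeight M₂.Indep v {x | x ∈ L} e (w e)) < w e →
      IsLocalRatioStack M₁ M₂ w δ u v (e :: L)

/-- `e` is paid for, up to the factor `1 + δ`, by thresholds `a`, `b` below which it is spanned by
the elements of `D` in the two matroids. -/
def IsCovered {α : Type*} (M₁ M₂ : Matroid α) (w : α → ℝ) (δ : ℝ) (u v : α → ℝ) (D : Set α)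
    (e : α) : Prop :=
  ∃ a b : ℝ, (0 ≤ a ∧ a ≤ w e) ∧ (0 ≤ b ∧ b ≤ w e) ∧ w e ≤ (1 + δ) * (a + b) ∧
    (∀ θ, 0 < θ → θ < a → e ∈ M₁.closure (superlevel u D θ)) ∧
    (∀ θ, 0 < θ → θ < b → e ∈ M₂.closure (superlevel v D θ))

namespace IsLocalRatioStack

variable {α : Type*} {M₁ M₂ : Matroid α} {w u v u' v' : α → ℝ} {δ B : ℝ} {L : List α} {e : α}

lemma symm (h : IsLocalRatioStack M₁ M₂ w δ u v L) : IsLocalRatioStack M₂ M₁ w δ v u L := by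
  induction h with
  | nil => exact nil
  | cons _ he h1 h2 hw hu hv hlt ih =>
    exact cons ih he h2 h1 hw hv hu (by rwa [add_comm (critWeight _ _ _ _ _)])

lemma congr (h : IsLocalRatioStack M₁ M₂ w δ u v L) (hu : ∀ x ∈ L, u x = u' x)
    (hv : ∀ x ∈ L, v x = v' x) : IsLocalRatioStack M₁ M₂ w δ u' v' L := by
  induction h with
  | nil => exact nil
  | @cons e L _ he h1 h2 hw hue hve hlt ih =>
    have hu' : ∀ x ∈ {x | x ∈ L}, u x = u' x := fun x hx => hu x (List.mem_cons_of_mem _ hx)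
    have hv' : ∀ x ∈ {x | x ∈ L}, v x = v' x := fun x hx => hv x (List.mem_cons_of_mem _ hx)
    refine cons (ih hu' hv') he h1 h2 hw ?_ ?_ ?_
    · rw [← hu e List.mem_cons_self, ← critWeight_congr hv', hue]
    · rw [← hv e List.mem_cons_self, ← critWeight_congr hu', hve]
    · rwa [← critWeight_congr hu', ← critWeight_congr hv']

lemma subset_ground (h : IsLocalRatioStack M₁ M₂ w δ u v L) : {x | x ∈ L} ⊆ M₁.E := by
  induction h with
  | nil => intro x hx; exact absurd hx List.not_mem_nil
  | cons _ _ h1 _ _ _ _ _ ih =>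
    intro x hx
    rcases List.mem_cons.1 hx with rfl | hx
    · exact h1
    · exact ih hx

lemma nodup (h : IsLocalRatioStack M₁ M₂ w δ u v L) : L.Nodup := by
  induction h with
  | nil => exact List.nodup_nil
  | cons _ he _ _ _ _ _ _ ih => exact List.nodup_cons.2 ⟨he, ih⟩

/-- The selection rule gives `b < w e / (1 + δ)`, so `u e` is at least the fraction `δ / (1 + δ)` of
`w e`; this keeps the number of weight classes finite. The last bound says that the gain is
nonnegative. -/
lemma bounds (h : IsLocalRatioStack M₁ M₂ w δ u v L) (hδ : 0 ≤ δ) (he : e ∈ L) :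
    0 < w e ∧ δ * w e ≤ (1 + δ) * u e ∧ u e ≤ w e ∧ w e ≤ u e + v e := by
  induction h with
  | nil => exact absurd he List.not_mem_nil
  | @cons f L _ _ _ _ hw hu hv hlt ih =>
    rcases List.mem_cons.1 he with rfl | he
    · have ha := critWeight_nonneg (u := u) (D := {x | x ∈ L}) (e := e) (c := w e) M₁.Indep
      have hb := critWeight_nonneg (u := v) (D := {x | x ∈ L}) (e := e) (c := w e) M₂.Indep
      refine ⟨hw, ?_, ?_, ?_⟩ <;> rw [hu] <;> try rw [hv]
      all_goals nlinarith [mul_nonneg hδ ha, mul_nonneg hδ hb]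
    · exact ih he

lemma nonneg (h : IsLocalRatioStack M₁ M₂ w δ u v L) (hδ : 0 ≤ δ) (he : e ∈ L) : 0 ≤ u e := by
  obtain ⟨hw, h1, -, -⟩ := h.bounds hδ he
  by_contra hneg
  nlinarith [mul_nonneg hδ hw.le]

lemma finite_setOf_mem (L : List α) : {x | x ∈ L}.Finite := L.finite_toSet

/-- A subset of the stack spans no more than the stack, so its critical weights are no larger and
each insertion raises the rank integral by at least the gain. -/
lemma sum_gain_le_layerRank (h : IsLocalRatioStack M₁ M₂ w δ u v L) (hδ : 0 ≤ δ)
    (hB : ∀ x ∈ L, w x ≤ B) (D : Finset α) (hD : ∀ x ∈ D, x ∈ L) :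
    ∑ x ∈ D, (u x + v x - w x) ≤ layerRank M₁ u B (D : Set α) := by
  classical
  induction h generalizing D with
  | nil =>
    have : D = ∅ := Finset.eq_empty_of_forall_notMem fun x hx => List.not_mem_nil (hD x hx)
    simp [this, layerRank_empty]
  | @cons e L hL he h1 h2 hw hu hv hlt ih =>
    have hB' : ∀ x ∈ L, w x ≤ B := fun x hx => hB x (List.mem_cons_of_mem _ hx)
    have hmem : ∀ x ∈ D.erase e, x ∈ L := fun x hx => by
      obtain ⟨hne, hx⟩ := Finset.mem_erase.1 hx
      exact (List.mem_cons.1 (hD x hx)).resolve_left hne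
    by_cases heD : e ∈ D
    · set a := critWeight M₁.Indep u {x | x ∈ L} e (w e) with ha
      have hb := (cons hL he h1 h2 hw hu hv hlt).bounds hδ List.mem_cons_self
      have hstep := le_layerRank_insert (M := M₁) (u := u) (B := B) (D := (D.erase e : Finset α))
        (e := e) (a := a) (Finset.finite_toSet _) h1 (critWeight_nonneg _)
        (by linarith [hb.2.2.2]) (hb.2.2.1.trans (hB e List.mem_cons_self)) (fun θ h3 h4 h5 => by
          refine not_le.2 h3 (le_critWeight hL.subset_ground h1 he
            ((critWeight_nonneg _).trans h3.le) (h4.trans hb.2.2.1) ?_)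
          exact M₁.closure_subset_closure (superlevel_mono fun x hx => hmem x hx) h5)
      rw [← Finset.coe_insert, Finset.insert_erase heD] at hstep
      rw [← Finset.sum_erase_add _ _ heD]
      linarith [ih hB' (D.erase e) hmem]
    · rw [Finset.erase_eq_of_notMem heD] at hmem
      exact ih hB' D hmem

lemma layerRank_le_sum_gain [DecidableEq α] (h : IsLocalRatioStack M₁ M₂ w δ u v L) (hδ : 0 ≤ δ)
    (hB : ∀ x ∈ L, w x ≤ B) :
    layerRank M₁ u B {x | x ∈ L} ≤ ∑ x ∈ L.toFinset, (u x + v x - w x) := by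
  induction h with
  | nil =>
    simp [layerRank_empty]
  | @cons e L hL he h1 h2 hw hu hv hlt ih =>
    have hB' : ∀ x ∈ L, w x ≤ B := fun x hx => hB x (List.mem_cons_of_mem _ hx)
    have hb := (cons hL he h1 h2 hw hu hv hlt).bounds hδ List.mem_cons_self
    have hstep := layerRank_insert_le (M := M₁) (u := u) (B := B) (D := {x | x ∈ L}) (e := e)
      (a := critWeight M₁.Indep u {x | x ∈ L} e (w e)) (finite_setOf_mem L) (critWeight_nonneg _)
      (by linarith [hb.2.2.2]) (hb.2.2.1.trans (hB e List.mem_cons_self))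
      (fun θ h3 h4 => mem_closure_of_lt_critWeight hL.subset_ground h1 he h3 h4)
    have hset : {x | x ∈ e :: L} = insert e {x | x ∈ L} := by ext; simp
    rw [hset, List.toFinset_cons, Finset.sum_insert (by simpa using he)]
    linarith [ih hB']

/-- A kept element spans itself up to the levels `u e` and `v e`, and `w e ≤ u e + v e`. -/
lemma isCovered (h : IsLocalRatioStack M₁ M₂ w δ u v L) (hδ : 0 ≤ δ) (he : e ∈ L) :
    IsCovered M₁ M₂ w δ u v {x | x ∈ L} e := by
  have h1 := h.bounds hδ he
  have h2 := h.symm.bounds hδ he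
  refine ⟨u e, v e, ⟨h.nonneg hδ he, h1.2.2.1⟩, ⟨h.symm.nonneg hδ he, h2.2.2.1⟩, ?_, ?_, ?_⟩
  · nlinarith [h.nonneg hδ he, h.symm.nonneg hδ he]
  · exact fun θ _ hθ => M₁.mem_closure_of_mem ⟨he, hθ.le⟩ (superlevel_subset.trans h.subset_ground)
  · exact fun θ _ hθ =>
      M₂.mem_closure_of_mem ⟨he, hθ.le⟩ (superlevel_subset.trans h.symm.subset_ground)

/-- The total gain bounds the weight of every common independent set of covered elements. -/
lemma weight_le_gain [DecidableEq α] (h : IsLocalRatioStack M₁ M₂ w δ u v L) (hδ : 0 ≤ δ)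
    (hB : ∀ x ∈ L, w x ≤ B) {I : Finset α} (hI : IsCommonIndep M₁ M₂ I) (hIB : ∀ x ∈ I, w x ≤ B)
    (hcov : ∀ x ∈ I, IsCovered M₁ M₂ w δ u v {x | x ∈ L} x) :
    ∑ x ∈ I, w x ≤ 2 * (1 + δ) * ∑ x ∈ L.toFinset, (u x + v x - w x) := by
  choose! a b ha hb hab hca hcb using hcov
  have h1 := (sum_le_layerRank (a := a) hI.1
    (fun x hx => ⟨(ha x hx).1, (ha x hx).2.trans (hIB x hx)⟩) hca (finite_setOf_mem L)).trans
    (h.layerRank_le_sum_gain hδ hB)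
  have h2 := (sum_le_layerRank (a := b) hI.2
    (fun x hx => ⟨(hb x hx).1, (hb x hx).2.trans (hIB x hx)⟩) hcb (finite_setOf_mem L)).trans
    (h.symm.layerRank_le_sum_gain hδ hB)
  have h3 : ∑ x ∈ L.toFinset, (v x + u x - w x) = ∑ x ∈ L.toFinset, (u x + v x - w x) :=
    Finset.sum_congr rfl fun x _ => by ring
  calc ∑ x ∈ I, w x ≤ ∑ x ∈ I, (1 + δ) * (a x + b x) := Finset.sum_le_sum hab
    _ = (1 + δ) * (∑ x ∈ I, a x + ∑ x ∈ I, b x) := by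
        rw [← Finset.mul_sum, Finset.sum_add_distrib]
    _ ≤ (1 + δ) * (2 * ∑ x ∈ L.toFinset, (u x + v x - w x)) :=
        mul_le_mul_of_nonneg_left (by linarith) (by linarith)
    _ = _ := by ring

/-- The stack contains a common independent set whose weight is at least the total gain. -/
lemma exists_gain_le_weight [DecidableEq α] (h : IsLocalRatioStack M₁ M₂ w δ u v L) (hδ : 0 ≤ δ)
    (hB : ∀ x ∈ L, w x ≤ B) :
    ∃ T : Finset α, (∀ x ∈ T, x ∈ L) ∧ IsCommonIndep M₁ M₂ T ∧
      ∑ x ∈ L.toFinset, (u x + v x - w x) ≤ ∑ x ∈ T, w x := by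
  -- Ties in weight are broken by position, since the kernel theorem needs injective keys.
  let k (f : α → ℝ) (x : α) : ℝ ×ₗ ℕ := toLex (f x, L.idxOf x)
  have hk (f : α → ℝ) : Set.InjOn (k f) {x | x ∈ L} := fun x hx y hy hxy => by
    have : (f x, L.idxOf x) = (f y, L.idxOf y) := toLex.injective hxy
    exact (List.idxOf_inj hx).1 (Prod.ext_iff.1 this).2
  obtain ⟨T', hTL, hT1, hT2, hcov⟩ := exists_matroid_kernel (finite_setOf_mem L) h.subset_ground
    h.symm.subset_ground (hk u) (hk v)
  obtain ⟨T, rfl⟩ := ((finite_setOf_mem L).subset hTL).exists_finset_coe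
  have hspan : ∀ (M : Matroid α) (f : α → ℝ), {x | x ∈ L} ⊆ M.E →
      ∀ e ∈ (T : Set α) ∪ dominated M (k f) {x | x ∈ L} T,
        e ∈ M.closure (superlevel f (T : Set α) (f e)) := by
    rintro M f hE e (he | he)
    · exact M.mem_closure_of_mem ⟨he, le_rfl⟩ (superlevel_subset.trans (hTL.trans hE))
    · refine M.closure_subset_closure ?_ he.2
      rintro x ⟨hx, hlt⟩
      refine ⟨hx, ?_⟩
      rcases (Prod.Lex.toLex_lt_toLex).1 hlt with h' | h'
      · exact h'.le
      · exact h'.1.le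
  have hsub : ∀ (M : Matroid α) (f : α → ℝ),
      (T : Set α) ∪ dominated M (k f) {x | x ∈ L} T ⊆ {x | x ∈ L} :=
    fun M f => Set.union_subset hTL fun x hx => hx.1
  obtain ⟨D₁, hD₁⟩ := ((finite_setOf_mem L).subset (hsub M₁ u)).exists_finset_coe
  obtain ⟨D₂, hD₂⟩ := ((finite_setOf_mem L).subset (hsub M₂ v)).exists_finset_coe
  have hg : ∀ x ∈ L, 0 ≤ u x + v x - w x := fun x hx => by linarith [(h.bounds hδ hx).2.2.2]
  have e1 : ∑ x ∈ D₁, (u x + v x - w x) ≤ ∑ x ∈ T, u x := by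
    refine (h.sum_gain_le_layerRank hδ hB D₁ fun x hx => hsub M₁ u (hD₁ ▸ hx)).trans ?_
    refine layerRank_le_sum (fun x hx => ⟨h.nonneg hδ (hTL hx), ?_⟩) ?_ (Finset.finite_toSet _)
    · exact (h.bounds hδ (hTL hx)).2.2.1.trans (hB x (hTL hx))
    · rw [hD₁]; exact hspan M₁ u h.subset_ground
  have e2 : ∑ x ∈ D₂, (v x + u x - w x) ≤ ∑ x ∈ T, v x := by
    refine (h.symm.sum_gain_le_layerRank hδ hB D₂ fun x hx => hsub M₂ v (hD₂ ▸ hx)).trans ?_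
    refine layerRank_le_sum (fun x hx => ⟨h.symm.nonneg hδ (hTL hx), ?_⟩) ?_
      (Finset.finite_toSet _)
    · exact (h.symm.bounds hδ (hTL hx)).2.2.1.trans (hB x (hTL hx))
    · rw [hD₂]; exact hspan M₂ v h.symm.subset_ground
  have e2' : ∑ x ∈ D₂, (v x + u x - w x) = ∑ x ∈ D₂, (u x + v x - w x) :=
    Finset.sum_congr rfl fun x _ => by ring
  have hun : ∑ x ∈ L.toFinset, (u x + v x - w x) ≤ ∑ x ∈ D₁ ∪ D₂, (u x + v x - w x) := by
    refine Finset.sum_le_sum_of_subset_of_nonneg (fun x hx => ?_) fun x hx _ => hg x ?_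
    · rw [← Finset.mem_coe, Finset.coe_union, hD₁, hD₂]
      rcases hcov (List.mem_toFinset.1 hx) with h' | h'
      · exact Or.inl h'
      · exact Or.inr (Or.inr h')
    · rw [← Finset.mem_coe, Finset.coe_union, hD₁, hD₂] at hx
      exact hx.elim (fun h' => hsub _ _ h') (fun h' => hsub _ _ h')
  have hint : ∑ x ∈ T, (u x + v x - w x) ≤ ∑ x ∈ D₁ ∩ D₂, (u x + v x - w x) := by
    refine Finset.sum_le_sum_of_subset_of_nonneg (fun x hx => ?_) fun x hx _ => hg x ?_
    · rw [← Finset.mem_coe, Finset.coe_inter, hD₁, hD₂]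
      exact ⟨Or.inl hx, Or.inl hx⟩
    · rw [← Finset.mem_coe, Finset.coe_inter, hD₁, hD₂] at hx
      exact hsub _ _ hx.1
  -- Writing `g` for the gain: `g(L) + g(T) ≤ g(D₁) + g(D₂) ≤ u(T) + v(T) = g(T) + w(T)`, and `g(T)`
  -- cancels.
  have hsum := Finset.sum_union_inter (s₁ := D₁) (s₂ := D₂) (f := fun x => u x + v x - w x)
  have hT : ∑ x ∈ T, (u x + v x - w x) = ∑ x ∈ T, u x + ∑ x ∈ T, v x - ∑ x ∈ T, w x := by
    rw [Finset.sum_sub_distrib, Finset.sum_add_distrib]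
  exact ⟨T, fun x hx => hTL hx, ⟨hT1, hT2⟩, by linarith⟩

/-- Elements whose weights in `M₁` lie within a factor `1 + δ` are independent in `M₁`. -/
lemma indep_weight_class (h : IsLocalRatioStack M₁ M₂ w δ u v L) (hδ : 0 ≤ δ) {θ : ℝ}
    (hθ : 0 < θ) : M₁.Indep {x | x ∈ L ∧ θ ≤ u x ∧ u x < (1 + δ) * θ} := by
  induction h with
  | nil => simp
  | @cons e L hL he h1 h2 hw hu hv hlt ih =>
    by_cases hc : θ ≤ u e ∧ u e < (1 + δ) * θ
    · have hset : {x | x ∈ e :: L ∧ θ ≤ u x ∧ u x < (1 + δ) * θ} =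
          insert e {x | x ∈ L ∧ θ ≤ u x ∧ u x < (1 + δ) * θ} := by
        ext x
        simp only [List.mem_cons, Set.mem_insert_iff, Set.mem_ofPred_eq]
        constructor
        · rintro ⟨rfl | hx, hx'⟩
          · exact Or.inl rfl
          · exact Or.inr ⟨hx, hx'⟩
        · rintro (rfl | ⟨hx, hx'⟩)
          · exact ⟨Or.inl rfl, hc⟩
          · exact ⟨Or.inr hx, hx'⟩
      rw [hset]
      refine ih.insert_indep_iff.2 (Or.inl ⟨h1, fun hmem => ?_⟩)
      have hb := critWeight_nonneg (u := v) (D := {x | x ∈ L}) (e := e) (c := w e) M₂.Indep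
      have hcl : e ∈ M₁.closure (superlevel u {x | x ∈ L} θ) := by
        refine M₁.closure_subset_closure ?_ hmem
        exact fun x hx => ⟨hx.1, hx.2.1⟩
      have hle := le_critWeight hL.subset_ground h1 he hθ.le (c := w e) (by linarith) hcl
      -- If `e` were spanned, its critical weight `a` would be at least `θ`, and `u e = w e - b > (1
      -- + δ) * a + δ * b ≥ (1 + δ) * θ` leaves the class.
      nlinarith [mul_nonneg hδ hb, mul_le_mul_of_nonneg_left hle hδ]
    · refine ih.subset ?_
      rintro x ⟨hx, hx'⟩
      rcases List.mem_cons.1 hx with rfl | hx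
      · exact absurd hx' hc
      · exact ⟨hx, hx'⟩

end IsLocalRatioStack

/-! ### Counting weight classes and bounding the space. -/

section Space

variable {α : Type*} {M₁ M₂ : Matroid α} {w u v : α → ℝ} {δ lo hi : ℝ} {L : List α}

lemma card_le_commonRank (hE : M₁.E.Finite) {I : Finset α} (hI : IsCommonIndep M₁ M₂ I) :
    I.card ≤ commonRank M₁ M₂ := by
  refine le_csSup ⟨M₁.E.ncard, ?_⟩ ⟨I, hI, rfl⟩
  rintro k ⟨J, hJ, rfl⟩
  rw [← Set.ncard_coe_finset]
  exact Set.ncard_le_ncard hJ.1.subset_ground hE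

/-- The number of weight classes of ratio `1 + δ` that cover the interval `[lo, hi]`. -/
noncomputable def classCount (δ lo hi : ℝ) : ℕ := ⌊Real.log (hi / lo) / Real.log (1 + δ)⌋₊ + 1

lemma IsLocalRatioStack.card_le_of_subset_closure (h : IsLocalRatioStack M₁ M₂ w δ u v L)
    (hδ : 0 < δ) (hlo : 0 < lo) (hu : ∀ x ∈ L, lo ≤ u x ∧ u x ≤ hi) (A I : Finset α)
    (hA : ∀ x ∈ A, x ∈ L) (hAI : ∀ x ∈ A, x ∈ M₁.closure (I : Set α)) :
    A.card ≤ I.card * classCount δ lo hi := by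
  classical
  have hlog : 0 < Real.log (1 + δ) := Real.log_pos (by linarith)
  have hq : ∀ x ∈ L, 0 ≤ Real.log (u x / lo) / Real.log (1 + δ) := fun x hx =>
    div_nonneg (Real.log_nonneg ((one_le_div hlo).2 (hu x hx).1)) hlog.le
  have key := Finset.card_le_mul_card_image_of_maps_to (s := A)
    (f := fun x => ⌊Real.log (u x / lo) / Real.log (1 + δ)⌋₊)
    (t := Finset.range (classCount δ lo hi)) (fun x hx => ?_) I.card (fun k _ => ?_)
  · rwa [Finset.card_range] at key
  · rw [Finset.mem_range, classCount, Nat.lt_succ_iff]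
    have hx' := hu x (hA x hx)
    have hup : 0 < u x := hlo.trans_le hx'.1
    gcongr
    exact hx'.2
  -- Class `k` consists of the `u`-weights in `[(1 + δ) ^ k * lo, (1 + δ) ^ (k + 1) * lo)`; it is
  -- independent and spanned by `I`.
  · have hθ : 0 < (1 + δ) ^ k * lo := by positivity
    refine (Matroid.Indep.card_le_finRk ((h.indep_weight_class hδ.le hθ).subset ?_)
      (Finset.finite_toSet I) (fun x hx => hAI x (Finset.mem_filter.1 (Finset.mem_coe.1 hx)).1)).trans
      (Matroid.finRk_coe_le_card I)
    intro x hx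
    obtain ⟨hxA, hxk⟩ := Finset.mem_filter.1 (Finset.mem_coe.1 hx)
    have hxL := hA x hxA
    have hup : 0 < u x / lo := div_pos (hlo.trans_le (hu x hxL).1) hlo
    obtain ⟨h1, h2⟩ := (Nat.floor_eq_iff (hq x hxL)).1 hxk
    rw [le_div_iff₀ hlog, ← Real.log_pow, Real.log_le_log_iff (by positivity) hup,
      le_div_iff₀ hlo] at h1
    rw [div_lt_iff₀ hlog] at h2
    have h2' : Real.log (u x / lo) < Real.log ((1 + δ) ^ (k + 1)) := by
      rw [Real.log_pow]; exact_mod_cast h2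
    rw [Real.log_lt_log_iff hup (by positivity), div_lt_iff₀ hlo, pow_succ] at h2'
    exact ⟨hxL, h1, by linarith⟩

lemma IsLocalRatioStack.length_le (h : IsLocalRatioStack M₁ M₂ w δ u v L) (hδ : 0 < δ)
    (hE : M₁.E.Finite) (hlo : 0 < lo) (hu : ∀ x ∈ L, lo ≤ u x ∧ u x ≤ hi)
    (hv : ∀ x ∈ L, lo ≤ v x ∧ v x ≤ hi) :
    L.length ≤ 2 * (commonRank M₁ M₂ * classCount δ lo hi) := by
  classical
  -- By maximality, an element of `L` outside both closures of `I` could be added to `I`.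
  obtain ⟨I, hI, hmax⟩ := Finset.exists_max_image
    (L.toFinset.powerset.filter (IsCommonIndep M₁ M₂)) Finset.card
    ⟨∅, Finset.mem_filter.2 ⟨Finset.empty_mem_powerset _, by simp [IsCommonIndep]⟩⟩
  obtain ⟨hIL, hI⟩ := Finset.mem_filter.1 hI
  rw [Finset.mem_powerset] at hIL
  have hcov : L.toFinset ⊆ (L.toFinset.filter fun x => x ∈ M₁.closure (I : Set α)) ∪
      (L.toFinset.filter fun x => x ∈ M₂.closure (I : Set α)) := by
    intro x hx
    by_contra hcon
    simp only [Finset.mem_union, Finset.mem_filter, hx, true_and, not_or] at hcon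
    have hxL := List.mem_toFinset.1 hx
    have hxI : x ∉ I := fun h' => hcon.1 (M₁.mem_closure_of_mem h' hI.1.subset_ground)
    have hins : IsCommonIndep M₁ M₂ (insert x I) := by
      constructor <;> rw [Finset.coe_insert]
      · exact hI.1.insert_indep_iff.2 (Or.inl ⟨h.subset_ground hxL, hcon.1⟩)
      · exact hI.2.insert_indep_iff.2 (Or.inl ⟨h.symm.subset_ground hxL, hcon.2⟩)
    have := hmax (insert x I) (Finset.mem_filter.2
      ⟨Finset.mem_powerset.2 (Finset.insert_subset hx hIL), hins⟩)
    rw [Finset.card_insert_of_notMem hxI] at this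
    omega
  rw [← List.toFinset_card_of_nodup h.nodup]
  refine ((Finset.card_le_card hcov).trans (Finset.card_union_le _ _)).trans ?_
  have h1 := h.card_le_of_subset_closure hδ hlo hu
    (L.toFinset.filter fun x => x ∈ M₁.closure (I : Set α)) I
    (fun x hx => List.mem_toFinset.1 (Finset.mem_filter.1 hx).1)
    (fun x hx => (Finset.mem_filter.1 hx).2)
  have h2 := h.symm.card_le_of_subset_closure hδ hlo hv
    (L.toFinset.filter fun x => x ∈ M₂.closure (I : Set α)) I
    (fun x hx => List.mem_toFinset.1 (Finset.mem_filter.1 hx).1)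
    (fun x hx => (Finset.mem_filter.1 hx).2)
  have h3 := Nat.mul_le_mul_right (classCount δ lo hi) (card_le_commonRank hE hI)
  omega

lemma classCount_factors_le {ε : ℝ} (hε : 0 < ε) :
    1 / Real.log (1 + ε) ≤ 9 * gammaEps ε ∧
      1 + Real.log ((1 + ε) / ε) / Real.log (1 + ε) ≤ 9 * gammaEps ε := by
  have hpos : 0 < (1 / ε) ^ (1 / ε) := Real.rpow_pos_of_pos (by positivity) _
  have hγ : (1 / ε) ^ (1 / ε) ≤ (gammaEps ε : ℝ) := Nat.le_ceil _
  have hγ1 : (1 : ℝ) ≤ gammaEps ε := by exact_mod_cast Nat.ceil_pos.2 hpos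
  have hlog : 0 < Real.log (1 + ε) := Real.log_pos (by linarith)
  rcases le_total 1 ε with h1 | h1
  · have hl : (1 / 2 : ℝ) ≤ Real.log (1 + ε) := by
      have := Real.log_le_log (by norm_num : (0 : ℝ) < 2) (by linarith : (2 : ℝ) ≤ 1 + ε)
      linarith [Real.log_two_gt_d9]
    have hr : Real.log ((1 + ε) / ε) ≤ 1 := by
      refine (Real.log_le_sub_one_of_pos (by positivity)).trans ?_
      rw [sub_le_iff_le_add, div_le_iff₀ hε]; linarith
    constructor
    · rw [div_le_iff₀ hlog]; nlinarith
    · have : Real.log ((1 + ε) / ε) / Real.log (1 + ε) ≤ 2 := by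
        rw [div_le_iff₀ hlog]; linarith
      linarith
  · set x := 1 / ε with hx
    have hx1 : 1 ≤ x := (one_le_div hε).2 h1
    have hx0 : 0 < x := by linarith
    -- With `x = 1 / ε` the two factors are `O(x)` and `O(x ^ 2)`, while `x ^ x ≥ exp (x - 1) ≥ ((x
    -- + 1) / 2) ^ 2`.
    have hxx : x ^ 2 ≤ 4 * gammaEps ε := by
      have hlx : 1 - x⁻¹ ≤ Real.log x := Real.one_sub_inv_le_log_of_pos hx0
      have h2 : x - 1 ≤ Real.log x * x := by
        have := mul_le_mul_of_nonneg_right hlx hx0.le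
        rwa [sub_mul, inv_mul_cancel₀ hx0.ne', one_mul] at this
      have h3 : Real.exp (x - 1) ≤ x ^ x := by
        rw [Real.rpow_def_of_pos hx0]; exact Real.exp_le_exp.2 h2
      have h4 : (x + 1) / 2 ≤ Real.exp ((x - 1) / 2) := by
        linarith [Real.add_one_le_exp ((x - 1) / 2)]
      have h5 : Real.exp (x - 1) = Real.exp ((x - 1) / 2) ^ 2 := by
        rw [← Real.exp_nat_mul]; congr 1; push_cast; ring
      nlinarith [pow_le_pow_left₀ (by positivity) h4 2]
    have hinv : 1 / Real.log (1 + ε) ≤ 2 * x := by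
      have hl : 1 - (1 + ε)⁻¹ ≤ Real.log (1 + ε) := Real.one_sub_inv_le_log_of_pos (by linarith)
      have h2 : ε / 2 ≤ 1 - (1 + ε)⁻¹ := by
        rw [le_sub_iff_add_le, ← le_sub_iff_add_le', inv_le_iff_one_le_mul₀ (by linarith)]
        nlinarith
      rw [div_le_iff₀ hlog]
      calc (1 : ℝ) = 2 * x * (ε / 2) := by rw [hx]; field_simp
        _ ≤ _ := mul_le_mul_of_nonneg_left (h2.trans hl) (by positivity)
    have hr : Real.log ((1 + ε) / ε) ≤ x := by
      refine (Real.log_le_sub_one_of_pos (by positivity)).trans (le_of_eq ?_)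
      rw [hx]; field_simp; ring
    have hr0 : Real.log ((1 + ε) / ε) / Real.log (1 + ε) ≤ x * (2 * x) := by
      rw [div_eq_mul_one_div]
      exact mul_le_mul hr hinv (by positivity) hx0.le
    constructor <;> nlinarith

end Space

/-! ### The streaming algorithm and its invariant. -/

section Algorithm

variable {α : Type*}

open Classical in
/-- The weights in the two matroids of the stored elements (last arrival first), recomputed from
the stored elements and the oracles. -/
noncomputable def splitWeights (O₁ O₂ : Set α → Prop) : List (α × ℝ) → (α → ℝ) × (α → ℝ)
  | [] => (0, 0)
  | x :: m =>
    (Function.update (splitWeights O₁ O₂ m).1 x.1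
      (x.2 - critWeight O₂ (splitWeights O₁ O₂ m).2 (storedElements m) x.1 x.2),
    Function.update (splitWeights O₁ O₂ m).2 x.1
      (x.2 - critWeight O₁ (splitWeights O₁ O₂ m).1 (storedElements m) x.1 x.2))

open Classical in
/-- The local ratio rule: keep an arriving element if its weight exceeds `1 + δ` times the sum of
its critical weights in the two matroids. -/
noncomputable def localRatioUpdate (δ : ℝ) (m : List (α × ℝ)) (x : α × ℝ)
    (O₁ O₂ : Set α → Prop) : List (α × ℝ) :=
  if (1 + δ) * (critWeight O₁ (splitWeights O₁ O₂ m).1 (storedElements m) x.1 x.2 +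
    critWeight O₂ (splitWeights O₁ O₂ m).2 (storedElements m) x.1 x.2) < x.2 then x :: m else m

/-- The weight recorded for the element `e` in the memory `m`. -/
noncomputable def storedWeight (m : List (α × ℝ)) (e : α) : ℝ := sSup {c | (e, c) ∈ m}

/-- `S` is a maximum weight set among the stored sets accepted by both oracles. -/
def IsBestStored (m : List (α × ℝ)) (O₁ O₂ : Set α → Prop) (S : Finset α) : Prop :=
  ((S : Set α) ⊆ storedElements m ∧ O₁ S ∧ O₂ S) ∧
    ∀ I : Finset α, (I : Set α) ⊆ storedElements m → O₁ I → O₂ I →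
      ∑ e ∈ I, storedWeight m e ≤ ∑ e ∈ S, storedWeight m e

open Classical in
/-- The local ratio algorithm, which outputs a maximum weight common independent set of stored
elements. -/
noncomputable def localRatioAlgorithm (α : Type*) (δ : ℝ) : OnePassAlgorithm α where
  update := localRatioUpdate δ
  update_subset m a O₁ O₂ x hx := by
    unfold localRatioUpdate at hx
    split_ifs at hx
    · exact (List.mem_cons.1 hx).symm
    · exact Or.inl hx
  output m O₁ O₂ := if h : ∃ S, IsBestStored m O₁ O₂ S then h.choose else ∅
  output_subset m O₁ O₂ := by
    split_ifs with h
    · exact h.choose_spec.1.1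
    · simp

variable {M₁ M₂ : Matroid α} {w u v u' v' : α → ℝ} {δ : ℝ} {L : List α} {e : α} {D D' : Set α}

lemma storedElements_map : storedElements (L.map fun e => (e, w e)) = {x | x ∈ L} := by
  ext x; simp [storedElements]

lemma storedWeight_map (he : e ∈ L) : storedWeight (L.map fun e => (e, w e)) e = w e := by
  have : {c | (e, c) ∈ L.map fun e => (e, w e)} = {w e} := by
    ext c; simp [he, eq_comm]
  rw [storedWeight, this, csSup_singleton]

lemma storedElements_cons (x : α × ℝ) (m : List (α × ℝ)) :
    storedElements (x :: m) = insert x.1 (storedElements m) := by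
  ext e
  simp only [storedElements, List.mem_cons, Set.mem_insert_iff, Set.mem_ofPred_eq]
  constructor
  · rintro ⟨c, h | h⟩
    · exact Or.inl (congrArg Prod.fst h)
    · exact Or.inr ⟨c, h⟩
  · rintro (rfl | ⟨c, h⟩)
    · exact ⟨x.2, Or.inl rfl⟩
    · exact ⟨c, Or.inr h⟩

/-- The weights `u`, `v` need not be stored: recomputing them queries only sets of stored elements,
on which the restricted oracles are exact. -/
lemma splitWeights_indepOracle {R : Set α} (m : List (α × ℝ)) (hm : storedElements m ⊆ R) :
    splitWeights (indepOracle M₁ R) (indepOracle M₂ R) m =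
      splitWeights M₁.Indep M₂.Indep m := by
  induction m with
  | nil => rfl
  | cons x m ih =>
    rw [storedElements_cons, Set.insert_subset_iff] at hm
    simp only [splitWeights, ih hm.2, critWeight_indepOracle hm.2 hm.1]

lemma IsCovered.mono (h : IsCovered M₁ M₂ w δ u v D e) (hD : D ⊆ D') (hu : ∀ x ∈ D, u x = u' x)
    (hv : ∀ x ∈ D, v x = v' x) : IsCovered M₁ M₂ w δ u' v' D' e := by
  obtain ⟨a, b, ha, hb, hab, h1, h2⟩ := h
  refine ⟨a, b, ha, hb, hab, fun θ h3 h4 => ?_, fun θ h3 h4 => ?_⟩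
  · refine M₁.closure_subset_closure ?_ (h1 θ h3 h4)
    rw [superlevel_congr hu]
    exact superlevel_mono hD
  · refine M₂.closure_subset_closure ?_ (h2 θ h3 h4)
    rw [superlevel_congr hv]
    exact superlevel_mono hD

/-- The invariant of the local ratio algorithm. -/
lemma localRatioAlgorithm_memory (hδ : 0 ≤ δ) (hE : M₁.E = M₂.E) (hw : ∀ e ∈ M₁.E, 0 < w e)
    (τ : List α) (hτ : τ.Nodup) (hτE : ∀ e ∈ τ, e ∈ M₁.E) :
    ∃ (L : List α) (u v : α → ℝ),
      (localRatioAlgorithm α δ).memory M₁ M₂ w τ = L.map (fun e => (e, w e)) ∧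
      splitWeights M₁.Indep M₂.Indep (L.map fun e => (e, w e)) = (u, v) ∧
      (∀ x ∈ L, x ∈ τ) ∧ IsLocalRatioStack M₁ M₂ w δ u v L ∧
      ∀ e ∈ τ, IsCovered M₁ M₂ w δ u v {x | x ∈ L} e := by
  induction τ using List.reverseRecOn with
  | nil => exact ⟨[], 0, 0, rfl, rfl, by simp, .nil, by simp⟩
  | append_singleton τ e ih =>
    obtain ⟨hτ1, -, hdisj⟩ := List.nodup_append.1 hτ
    have heτ : e ∉ τ := fun h => hdisj e h e (List.mem_singleton_self e) rfl
    obtain ⟨L, u, v, hm, hs, hLτ, hL, hcov⟩ := ih hτ1 fun x hx => hτE x (by simp [hx])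
    have heE : e ∈ M₁.E := hτE e (by simp)
    have heE2 : e ∈ M₂.E := hE ▸ heE
    have heL : e ∉ L := fun h => heτ (hLτ e h)
    have hwe := hw e heE
    set a := critWeight M₁.Indep u {x | x ∈ L} e (w e) with ha
    set b := critWeight M₂.Indep v {x | x ∈ L} e (w e) with hb
    have hsub : {x | x ∈ L} ⊆ insert e {x | x ∈ L} := Set.subset_insert _ _
    have hmem : (localRatioAlgorithm α δ).memory M₁ M₂ w (τ ++ [e]) =
        if (1 + δ) * (a + b) < w e then (e :: L).map (fun e => (e, w e))
        else L.map (fun e => (e, w e)) := by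
      have hstep : (localRatioAlgorithm α δ).memory M₁ M₂ w (τ ++ [e]) =
          localRatioUpdate δ ((localRatioAlgorithm α δ).memory M₁ M₂ w τ) (e, w e)
            (indepOracle M₁ (insert e (storedElements
              ((localRatioAlgorithm α δ).memory M₁ M₂ w τ))))
            (indepOracle M₂ (insert e (storedElements
              ((localRatioAlgorithm α δ).memory M₁ M₂ w τ)))) := by
        simp only [OnePassAlgorithm.memory, List.foldl_append, List.foldl_cons, List.foldl_nil]
        rfl
      rw [hstep, hm, localRatioUpdate, splitWeights_indepOracle _ (Set.subset_insert _ _), hs,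
        storedElements_map, critWeight_indepOracle hsub (Set.mem_insert _ _),
        critWeight_indepOracle hsub (Set.mem_insert _ _)]
      rfl
    by_cases hacc : (1 + δ) * (a + b) < w e
    · classical
      have hne : ∀ x ∈ L, x ≠ e := fun x hx h => heL (h ▸ hx)
      have hu : ∀ x ∈ {x | x ∈ L}, u x = Function.update u e (w e - b) x := fun x hx =>
        (Function.update_of_ne (hne x hx) _ _).symm
      have hv : ∀ x ∈ {x | x ∈ L}, v x = Function.update v e (w e - a) x := fun x hx =>
        (Function.update_of_ne (hne x hx) _ _).symm
      have hstack : IsLocalRatioStack M₁ M₂ w δ (Function.update u e (w e - b))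
          (Function.update v e (w e - a)) (e :: L) := by
        refine .cons (hL.congr hu hv) heL heE heE2 hwe ?_ ?_ ?_
        · rw [Function.update_self, ← critWeight_congr hv]
        · rw [Function.update_self, ← critWeight_congr hu]
        · rwa [← critWeight_congr hv, ← critWeight_congr hu]
      refine ⟨e :: L, Function.update u e (w e - b), Function.update v e (w e - a), ?_, ?_, ?_,
        hstack, ?_⟩
      · rw [hmem, if_pos hacc]
      · simp only [List.map_cons, splitWeights, hs, storedElements_map, ← ha, ← hb]
      · intro x hx
        rcases List.mem_cons.1 hx with rfl | hx
        · simp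
        · simp [hLτ x hx]
      · intro x hx
        rcases List.mem_append.1 hx with hx | hx
        · exact (hcov x hx).mono (fun y hy => List.mem_cons_of_mem _ hy) hu hv
        · rw [List.mem_singleton.1 hx]
          exact hstack.isCovered hδ List.mem_cons_self
    · refine ⟨L, u, v, by rw [hmem, if_neg hacc], hs, fun x hx => by simp [hLτ x hx], hL, ?_⟩
      intro x hx
      rcases List.mem_append.1 hx with hx | hx
      · exact hcov x hx
      · rw [List.mem_singleton.1 hx]
        exact ⟨a, b, ⟨critWeight_nonneg _, critWeight_le _ hwe.le⟩,
          ⟨critWeight_nonneg _, critWeight_le _ hwe.le⟩, not_lt.1 hacc,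
          fun θ h1 h2 => mem_closure_of_lt_critWeight hL.subset_ground heE heL h1 h2,
          fun θ h1 h2 => mem_closure_of_lt_critWeight hL.symm.subset_ground heE2 heL h1 h2⟩

/-- The output is a maximum weight common independent subset of the stored elements. -/
lemma localRatioAlgorithm_result {σ : List α}
    (hm : (localRatioAlgorithm α δ).memory M₁ M₂ w σ = L.map (fun e => (e, w e))) :
    IsCommonIndep M₁ M₂ ((localRatioAlgorithm α δ).result M₁ M₂ w σ) ∧
      ∀ T : Finset α, (∀ x ∈ T, x ∈ L) → IsCommonIndep M₁ M₂ T →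
        ∑ e ∈ T, w e ≤ ∑ e ∈ (localRatioAlgorithm α δ).result M₁ M₂ w σ, w e := by
  classical
  set m := L.map (fun e => (e, w e)) with hmdef
  set O₁ := indepOracle M₁ (storedElements m)
  set O₂ := indepOracle M₂ (storedElements m)
  have hst : storedElements m = {x | x ∈ L} := storedElements_map
  have hwt : ∀ I : Finset α, (I : Set α) ⊆ storedElements m →
      ∑ e ∈ I, storedWeight m e = ∑ e ∈ I, w e := fun I hI =>
    Finset.sum_congr rfl fun e he => storedWeight_map (by rw [hst] at hI; exact hI he)
  have hex : ∃ S, IsBestStored m O₁ O₂ S := by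
    obtain ⟨S, hS, hmax⟩ := Finset.exists_max_image
      (L.toFinset.powerset.filter fun I : Finset α => O₁ (I : Set α) ∧ O₂ (I : Set α))
      (fun I : Finset α => ∑ e ∈ I, storedWeight m e)
      ⟨∅, Finset.mem_filter.2 ⟨Finset.empty_mem_powerset _, by simp [O₁, O₂, indepOracle]⟩⟩
    obtain ⟨-, hS⟩ := Finset.mem_filter.1 hS
    refine ⟨S, ⟨hS.1.1, hS⟩, fun I hI h1 h2 => hmax I (Finset.mem_filter.2 ⟨?_, h1, h2⟩)⟩
    rw [Finset.mem_powerset]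
    intro x hx
    rw [hst] at hI
    exact List.mem_toFinset.2 (hI hx)
  have hres : (localRatioAlgorithm α δ).result M₁ M₂ w σ = hex.choose := by
    rw [OnePassAlgorithm.result, hm]
    exact dif_pos hex
  obtain ⟨⟨hS, h1, h2⟩, hmax⟩ := hex.choose_spec
  rw [hres]
  refine ⟨⟨h1.2, h2.2⟩, fun T hT hTi => ?_⟩
  have hTs : (T : Set α) ⊆ storedElements m := by rw [hst]; exact hT
  have := hmax T hTs ⟨hTs, hTi.1⟩ ⟨hTs, hTi.2⟩
  rwa [hwt T hTs, hwt _ hS] at this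

end Algorithm

/-! ### Assembling the approximation and space bounds. -/

theorem mainTheorem12 :
    ∃ C : ℝ, 0 < C ∧ ∀ ε : ℝ, 0 < ε → ∀ α : Type*, ∃ A : OnePassAlgorithm α,
      ∀ (M₁ M₂ : Matroid α) (w : α → ℝ) (σ : List α),
        M₁.E = M₂.E → (∀ e ∈ M₁.E, 0 < w e) →
        σ.Nodup → (∀ e, e ∈ σ ↔ e ∈ M₁.E) →
        IsApproxMaxWeightCommonIndep M₁ M₂ w (1 / 2 - ε) (A.result M₁ M₂ w σ) ∧
        A.UsesSpaceAtMost M₁ M₂ w σ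
          (C * gammaEps ε * commonRank M₁ M₂ * (1 + Real.log (weightRatio M₁.E w))) := by
  classical
  -- `18 = 2 * 9`: two matroids, and the factor `9` of `classCount_factors_le`. The slack is `δ =
  -- ε`.
  refine ⟨18, by norm_num, fun ε hε α => ⟨localRatioAlgorithm α ε, ?_⟩⟩
  intro M₁ M₂ w σ hE hw hσ hσE
  have hfin : M₁.E.Finite := σ.finite_toSet.subset fun e he => (hσE e).2 he
  have hwB : ∀ e ∈ M₁.E, w e ≤ sSup (w '' M₁.E) := fun e he =>
    le_csSup (hfin.image w).bddAbove ⟨e, he, rfl⟩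
  constructor
  · obtain ⟨L, u, v, hm, -, hLσ, hL, hcov⟩ :=
      localRatioAlgorithm_memory hε.le hE hw σ hσ fun e he => (hσE e).1 he
    obtain ⟨hres, hbest⟩ := localRatioAlgorithm_result hm
    refine ⟨hres, fun I hI => ?_⟩
    have hLB : ∀ x ∈ L, w x ≤ sSup (w '' M₁.E) := fun x hx => hwB x (hL.subset_ground hx)
    obtain ⟨T, hTL, hT, hgain⟩ := hL.exists_gain_le_weight hε.le hLB
    have hI' := hL.weight_le_gain hε.le hLB hI (fun x hx => hwB x (hI.1.subset_ground hx))
      (fun x hx => hcov x ((hσE x).2 (hI.1.subset_ground hx)))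
    have hTS := hbest T hTL hT
    have hI0 : 0 ≤ ∑ e ∈ I, w e :=
      Finset.sum_nonneg fun e he => (hw e (hI.1.subset_ground he)).le
    have hS0 : 0 ≤ ∑ e ∈ (localRatioAlgorithm α ε).result M₁ M₂ w σ, w e :=
      Finset.sum_nonneg fun e he => (hw e (hres.1.subset_ground he)).le
    set S := ∑ e ∈ (localRatioAlgorithm α ε).result M₁ M₂ w σ, w e
    have hIS : ∑ e ∈ I, w e ≤ 2 * (1 + ε) * S :=
      hI'.trans (mul_le_mul_of_nonneg_left (hgain.trans hTS) (by positivity))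
    rcases le_total (1 / 2 - ε) 0 with h | h
    · exact (mul_nonpos_of_nonpos_of_nonneg h hI0).trans hS0
    · refine (mul_le_mul_of_nonneg_left hIS h).trans ?_
      -- `(1/2 - ε) * 2 * (1 + ε) = 1 - ε - 2 * ε ^ 2 ≤ 1`.
      nlinarith [mul_nonneg hε.le hS0, mul_nonneg (mul_nonneg hε.le hε.le) hS0]
  · intro τ hτ
    obtain ⟨L, u, v, hm, -, hLτ, hL, -⟩ := localRatioAlgorithm_memory hε.le hE hw τ
      (hσ.sublist hτ.sublist) fun e he => (hσE e).1 (hτ.subset he)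
    rw [hm, List.length_map]
    rcases M₁.E.eq_empty_or_nonempty with h0 | hne
    · have hL0 : L = [] := List.eq_nil_iff_forall_not_mem.2 fun x hx => by
        have := hL.subset_ground hx
        rw [h0] at this
        exact this
      rw [hL0, h0]
      -- On an empty ground set the ratio is `0 / 0 = 0` and `Real.log 0 = 0`, so the bound is still
      -- nonnegative.
      simp only [List.length_nil, Nat.cast_zero, weightRatio, Set.image_empty, Real.sSup_empty, zero_div,
        Real.log_zero]
      positivity
    · set W := weightRatio M₁.E w with hW
      set lo := sInf (w '' M₁.E) with hlo
      set hi := sSup (w '' M₁.E) with hhi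
      have hlo0 : 0 < lo := by
        obtain ⟨e, he, h⟩ := (hne.image w).csInf_mem (hfin.image w)
        exact (hw e he).trans_eq h
      have hloB : ∀ e ∈ M₁.E, lo ≤ w e := fun e he =>
        csInf_le (hfin.image w).bddBelow ⟨e, he, rfl⟩
      have hW1 : 1 ≤ W := by
        obtain ⟨e, he⟩ := hne
        exact (one_le_div hlo0).2 ((hloB e he).trans (hwB e he))
      have hc : 0 < ε / (1 + ε) * lo := by positivity
      have hlower : ∀ x t, x ∈ L → ε * w x ≤ (1 + ε) * t → ε / (1 + ε) * lo ≤ t := by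
        intro x t hx h
        rw [div_mul_eq_mul_div, div_le_iff₀ (by positivity)]
        nlinarith [hloB x (hL.subset_ground hx)]
      have hlen := hL.length_le hε hfin (hi := hi) hc
        (fun x hx => ⟨hlower x _ hx (hL.bounds hε.le hx).2.1,
          (hL.bounds hε.le hx).2.2.1.trans (hwB x (hL.subset_ground hx))⟩)
        (fun x hx => ⟨hlower x _ hx (hL.symm.bounds hε.le hx).2.1,
          (hL.symm.bounds hε.le hx).2.2.1.trans (hwB x (hL.subset_ground hx))⟩)
      have hratio : hi / (ε / (1 + ε) * lo) = W * ((1 + ε) / ε) := by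
        rw [hW, weightRatio, ← hlo, ← hhi]
        field_simp
      have hlogW : 0 ≤ Real.log W := Real.log_nonneg hW1
      have hlog : 0 < Real.log (1 + ε) := Real.log_pos (by linarith)
      have hlog2 : 0 ≤ Real.log ((1 + ε) / ε) :=
        Real.log_nonneg ((one_le_div hε).2 (by linarith))
      obtain ⟨hg1, hg2⟩ := classCount_factors_le hε
      have hcount : (classCount ε (ε / (1 + ε) * lo) hi : ℝ) ≤
          9 * gammaEps ε * (1 + Real.log W) := by
        rw [classCount, hratio, Real.log_mul (by positivity) (by positivity)]
        push_cast
        have hfl := Nat.floor_le (div_nonneg (add_nonneg hlogW hlog2) hlog.le)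
        have h1 := mul_le_mul_of_nonneg_left hg1 hlogW
        rw [add_div, div_eq_mul_one_div (Real.log W)] at hfl
        rw [add_div, div_eq_mul_one_div (Real.log W)]
        linarith
      have hlen' : (L.length : ℝ) ≤
          2 * (commonRank M₁ M₂ * classCount ε (ε / (1 + ε) * lo) hi) := by exact_mod_cast hlen
      refine hlen'.trans ?_
      have := mul_le_mul_of_nonneg_left hcount (Nat.cast_nonneg (α := ℝ) (commonRank M₁ M₂))
      linarith
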